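/- Let $\mathfrak g$ be a finite-dimensional complex semisimple Lie algebra with Killing form $\kappa$, and let $w(x,y,z)=\kappa([x,y],z)$, an alternating trilinear form on $\mathfrak g$. A nullspace is a linear subspace of $\mathfrak g$ on which $w$ vanishes identically; a maximal nullspace is a nullspace of maximal dimension. Let $d\ge 0$ be an integer (the case of interest being $d=\frac{1}{2}(\dim\mathfrak g+\mathrm{rank}\,\mathfrak g)$), let $\mathbb G=\mathbb G(d,\mathfrak g)$ be the Grassmannian of $d$-dimensional subspaces of $\mathfrak g$, let $K\subset\mathfrak g\otimes\mathcal O_{\mathbb G}$ be its tautological subsheaf of rank $d$, put $\mathcal O_{\mathbb G}(-1)=\bigwedge^d K$, and write $F(1)=\mathcal Hom(\mathcal O_{\mathbb G}(-1),F)$. Let $I_Y\subset\mathcal O_{\mathbb G}$ be the ideal sheaf that is the image of the morphism ${}^tw_1:\bigwedge^3K\to\mathcal O_{\mathbb G}$ induced by $w$, and let $Y\subset\mathbb G$ be its zero locus. Then $Y$ is the set of all nullspaces of dimension $d$; in particular, if $d$ is the dimension of the maximal nullspaces, then $Y$ is the set of all maximal nullspaces. Moreover, the equations of $Y$ in $\mathbb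 G$ are linear: 1. if $d\ge 3$, then $\bigwedge^3K(1)\cong\bigwedge^{d-3}K^\vee$, and $\bigwedge^{d-3}K^\vee$ is generated by its global sections; for every $d$ the sheaf $\bigwedge^3K(1)$ is generated by its global sections; 2. the morphism $\bigwedge^3K(1)\to I_Y(1)$ induced by ${}^tw_1$ is surjective; 3. $I_Y(1)$ is generated by its global sections; more precisely, it is generated by those of its global sections that are restrictions to $\mathbb G$ of linear forms on $\bigwedge^d\mathfrak g$ (linear forms in the Plücker coordinates), and $Y$ is the set of the points of $\mathbb G$ at which all these linear forms vanish. -/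

import Mathlib

universe u v v'

open TopologicalSpace

noncomputable section

namespace NullGr

/-! ### The Grassmannian as a projective variety over `ℂ` -/

section Grassmannian

variable (d : ℕ) (V : Type u) [AddCommGroup V] [Module ℂ V]

/-- The Grassmannian of `d`-dimensional linear subspaces of `V` (closed points). -/
def Gr : Type u := {W : Submodule ℂ V // Module.Finite ℂ W ∧ Module.finrank ℂ W = d}

/-- Polynomials in the Plücker coordinates. The variables are the alternating `d`-forms on `V`,
that is, the linear forms on `⋀^d V`. -/
abbrev PluckerPoly : Type u := MvPolynomial (V [⋀^Fin d]→ₗ[ℂ] ℂ) ℂ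

variable {d V}

/-- `v` is a basis of the subspace `Λ`. -/
def IsFrame (Λ : Gr d V) (v : Fin d → V) : Prop :=
  LinearIndependent ℂ v ∧ Submodule.span ℂ (Set.range v) = Λ.1

/-- The value of a polynomial in the Plücker coordinates at the decomposable vector
`v 0 ∧ ⋯ ∧ v (d-1)`. -/
def pluckerEval (P : PluckerPoly d V) (v : Fin d → V) : ℂ :=
  MvPolynomial.eval (fun φ : V [⋀^Fin d]→ₗ[ℂ] ℂ => φ v) P

/-- The locus where `P` does not vanish (for `P` homogeneous, the choice of the basis of `Λ` is
immaterial). -/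
def nonvanishing (P : PluckerPoly d V) : Set (Gr d V) :=
  {Λ | ∀ v, IsFrame Λ v → pluckerEval P v ≠ 0}

/-- The Zariski topology: the one induced by the Plücker embedding in `ℙ(⋀^d V)`. -/
instance : TopologicalSpace (Gr d V) :=
  TopologicalSpace.generateFrom
    {D | ∃ (n : ℕ) (P : PluckerPoly d V), P.IsHomogeneous n ∧ D = nonvanishing P}

/-- Restriction of a (dependent) function on `U` to a smaller open set `W`. -/
def res {F : Gr d V → Type v} {U W : Opens (Gr d V)} (h : W ≤ U) (s : ∀ Λ : U, F Λ) :
    ∀ Λ : W, F Λ :=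
  fun Λ => s ⟨Λ.1, h Λ.2⟩

/-- Regular functions: locally quotients of two homogeneous polynomials of the same degree in the
Plücker coordinates. -/
def IsRegular {U : Opens (Gr d V)} (f : U → ℂ) : Prop :=
  ∀ x : U, ∃ (W : Opens (Gr d V)) (h : W ≤ U), x.1 ∈ W ∧
    ∃ (n : ℕ) (P Q : PluckerPoly d V), P.IsHomogeneous n ∧ Q.IsHomogeneous n ∧
      ∀ (y : W) (v : Fin d → V), IsFrame y.1 v →
        pluckerEval Q v ≠ 0 ∧ f ⟨y.1, h y.2⟩ = pluckerEval P v / pluckerEval Q v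

/-- The structure sheaf: the `ℂ`-algebra of regular functions on `U`. -/
def Reg (U : Opens (Gr d V)) : Subalgebra ℂ (U → ℂ) where
  carrier := {f | IsRegular f}
  algebraMap_mem' c x := by
    refine ⟨U, le_rfl, x.2, 0, MvPolynomial.C c, 1, MvPolynomial.isHomogeneous_C _ _,
      MvPolynomial.isHomogeneous_one _ _, fun y v _ => ?_⟩
    simp [pluckerEval]
  add_mem' := by
    intro f g hf hg x
    obtain ⟨W, h, hx, n, P, Q, hP, hQ, H⟩ := hf x
    obtain ⟨W', h', hx', n', P', Q', hP', hQ', H'⟩ := hg x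
    refine ⟨W ⊓ W', inf_le_left.trans h, ⟨hx, hx'⟩, n + n', P * Q' + Q * P', Q * Q',
      (hP.mul hQ').add (hQ.mul hP'), hQ.mul hQ', fun y v hv => ?_⟩
    obtain ⟨h1, h2⟩ := H ⟨y.1, y.2.1⟩ v hv
    obtain ⟨h1', h2'⟩ := H' ⟨y.1, y.2.2⟩ v hv
    simp only [pluckerEval, map_add, map_mul, Pi.add_apply] at *
    exact ⟨mul_ne_zero h1 h1', by rw [h2, h2', div_add_div _ _ h1 h1']⟩
  mul_mem' := by
    intro f g hf hg x
    obtain ⟨W, h, hx, n, P, Q, hP, hQ, H⟩ := hf x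
    obtain ⟨W', h', hx', n', P', Q', hP', hQ', H'⟩ := hg x
    refine ⟨W ⊓ W', inf_le_left.trans h, ⟨hx, hx'⟩, n + n', P * P', Q * Q',
      hP.mul hP', hQ.mul hQ', fun y v hv => ?_⟩
    obtain ⟨h1, h2⟩ := H ⟨y.1, y.2.1⟩ v hv
    obtain ⟨h1', h2'⟩ := H' ⟨y.1, y.2.2⟩ v hv
    simp only [pluckerEval, map_mul, Pi.mul_apply] at *
    exact ⟨mul_ne_zero h1 h1', by rw [h2, h2', div_mul_div_comm]⟩

theorem Reg.res_mem {U W : Opens (Gr d V)} (h : W ≤ U) {f : U → ℂ} (hf : f ∈ Reg U) :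
    res (F := fun _ => ℂ) h f ∈ Reg W := by
  intro x
  obtain ⟨W', h', hx, n, P, Q, hP, hQ, H⟩ := hf ⟨x.1, h x.2⟩
  exact ⟨W' ⊓ W, inf_le_right, ⟨hx, x.2⟩, n, P, Q, hP, hQ,
    fun y v hv => H ⟨y.1, y.2.1⟩ v hv⟩

theorem Reg.mem_of_local {U : Opens (Gr d V)} {f : U → ℂ}
    (hf : ∀ x : U, ∃ (W : Opens (Gr d V)) (h : W ≤ U), x.1 ∈ W ∧ res (F := fun _ => ℂ) h f ∈ Reg W) :
    f ∈ Reg U := by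
  intro x
  obtain ⟨W, h, hx, hW⟩ := hf x
  obtain ⟨W', h', hx', n, P, Q, hP, hQ, H⟩ := hW ⟨x.1, hx⟩
  exact ⟨W', h'.trans h, hx', n, P, Q, hP, hQ, H⟩

end Grassmannian

/-! ### Sheaves of modules over the structure sheaf -/

section Sheaves

variable (d : ℕ) (V : Type u) [AddCommGroup V] [Module ℂ V]

/-- A sheaf of modules over the structure sheaf of the Grassmannian whose sections over `U` are
functions assigning to each `Λ ∈ U` an element of a vector space `space Λ`. Such functions can
always be glued, so that the sheaf axioms say that membership in `sections` is stable under
restriction and can be tested locally. Vector bundles (with `space Λ` the fibre at `Λ`) and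
subsheaves of their sheaves of sections are of this kind. -/
structure SectionSheaf where
  space : Gr d V → Type v
  [addCommGroup : ∀ Λ, AddCommGroup (space Λ)]
  [module : ∀ Λ, Module ℂ (space Λ)]
  sections : ∀ U : Opens (Gr d V), Submodule (Reg U) (∀ Λ : U, space Λ)
  res_mem : ∀ {U W : Opens (Gr d V)} (h : W ≤ U) {s : ∀ Λ : U, space Λ},
    s ∈ sections U → res h s ∈ sections W
  mem_of_local : ∀ {U : Opens (Gr d V)} {s : ∀ Λ : U, space Λ},
    (∀ x : U, ∃ (W : Opens (Gr d V)) (h : W ≤ U), x.1 ∈ W ∧ res h s ∈ sections W) →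
      s ∈ sections U

attribute [instance] SectionSheaf.addCommGroup SectionSheaf.module

variable {d V}

/-- A morphism of sheaves of modules given by linear maps `F.space Λ → G.space Λ`. -/
structure SectionSheaf.Hom (F : SectionSheaf.{u, v} d V) (G : SectionSheaf.{u, v'} d V) where
  map : ∀ Λ, F.space Λ →ₗ[ℂ] G.space Λ
  map_mem : ∀ {U : Opens (Gr d V)} {s : ∀ Λ : U, F.space Λ},
    s ∈ F.sections U → (fun Λ : U => map Λ (s Λ)) ∈ G.sections U

/-- An isomorphism of sheaves of modules given by linear isomorphisms
`F.space Λ ≃ G.space Λ`. -/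
structure SectionSheaf.Iso (F : SectionSheaf.{u, v} d V) (G : SectionSheaf.{u, v'} d V) where
  equiv : ∀ Λ, F.space Λ ≃ₗ[ℂ] G.space Λ
  mem_iff : ∀ {U : Opens (Gr d V)} {s : ∀ Λ : U, F.space Λ},
    s ∈ F.sections U ↔ (fun Λ : U => equiv Λ (s Λ)) ∈ G.sections U

/-- A morphism of sheaves is surjective if every section of the target locally comes from a
section of the source. -/
def SectionSheaf.Hom.IsSurjective {F : SectionSheaf.{u, v} d V} {G : SectionSheaf.{u, v'} d V}
    (φ : F.Hom G) : Prop :=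
  ∀ (U : Opens (Gr d V)) (s : ∀ Λ : U, G.space Λ), s ∈ G.sections U →
    ∀ x : U, ∃ (W : Opens (Gr d V)) (h : W ≤ U), x.1 ∈ W ∧
      ∃ t ∈ F.sections W, (fun Λ : W => φ.map Λ (t Λ)) = res h s

/-- The image sheaf of a morphism: the sections of the target that locally come from sections of
the source. -/
abbrev SectionSheaf.Hom.image {F : SectionSheaf.{u, v} d V} {G : SectionSheaf.{u, v'} d V}
    (φ : F.Hom G) : SectionSheaf.{u, v'} d V where
  space := G.space
  sections U :=
    { carrier := {s | ∀ x : U, ∃ (W : Opens (Gr d V)) (h : W ≤ U), x.1 ∈ W ∧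
        ∃ t ∈ F.sections W, (fun Λ : W => φ.map Λ (t Λ)) = res h s}
      zero_mem' := fun x => ⟨U, le_rfl, x.2, 0, zero_mem _, by
        funext Λ; simp [res]⟩
      add_mem' := by
        intro s s' hs hs' x
        obtain ⟨W, h, hx, t, ht, e⟩ := hs x
        obtain ⟨W', h', hx', t', ht', e'⟩ := hs' x
        refine ⟨W ⊓ W', inf_le_left.trans h, ⟨hx, hx'⟩, res inf_le_left t + res inf_le_right t',
          add_mem (F.res_mem _ ht) (F.res_mem _ ht'), ?_⟩
        funext Λ
        have e1 := congrFun e ⟨Λ.1, Λ.2.1⟩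
        have e2 := congrFun e' ⟨Λ.1, Λ.2.2⟩
        simp only [res, Pi.add_apply, map_add] at *
        rw [e1, e2]
      smul_mem' := by
        intro f s hs x
        obtain ⟨W, h, hx, t, ht, e⟩ := hs x
        refine ⟨W, h, hx, (⟨res (F := fun _ => ℂ) h f.1, Reg.res_mem h f.2⟩ : Reg W) • t,
          Submodule.smul_mem _ _ ht, ?_⟩
        funext Λ
        have e1 := congrFun e Λ
        change φ.map Λ.1 (f.1 ⟨Λ.1, h Λ.2⟩ • t Λ) = f.1 ⟨Λ.1, h Λ.2⟩ • s ⟨Λ.1, h Λ.2⟩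
        rw [map_smul]
        exact congrArg _ e1 }
  res_mem := by
    intro U W h s hs x
    obtain ⟨W', h', hx, t, ht, e⟩ := hs ⟨x.1, h x.2⟩
    exact ⟨W' ⊓ W, inf_le_right, ⟨hx, x.2⟩, res inf_le_left t, F.res_mem _ ht,
      funext fun Λ => congrFun e ⟨Λ.1, Λ.2.1⟩⟩
  mem_of_local := by
    intro U s hs x
    obtain ⟨W, h, hx, hW⟩ := hs x
    obtain ⟨W', h', hx', t, ht, e⟩ := hW ⟨x.1, hx⟩
    exact ⟨W', h'.trans h, hx', t, ht, e⟩

/-- The morphism onto the image. -/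
def SectionSheaf.Hom.toImage {F : SectionSheaf.{u, v} d V} {G : SectionSheaf.{u, v'} d V}
    (φ : F.Hom G) : F.Hom φ.image where
  map := φ.map
  map_mem := fun {U s} hs x => ⟨U, le_rfl, x.2, s, hs, rfl⟩

/-- `F` is generated by the set `S` of global sections: every local section is, near each point,
a combination of elements of `S` with regular coefficients. -/
def SectionSheaf.GeneratedBy (F : SectionSheaf.{u, v} d V)
    (S : Set (∀ Λ : (⊤ : Opens (Gr d V)), F.space Λ)) : Prop :=
  S ⊆ F.sections ⊤ ∧
  ∀ (U : Opens (Gr d V)) (s : ∀ Λ : U, F.space Λ), s ∈ F.sections U →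
    ∀ x : U, ∃ (W : Opens (Gr d V)) (h : W ≤ U), x.1 ∈ W ∧
      res h s ∈ Submodule.span (Reg W) (res (le_top : W ≤ ⊤) '' S)

/-- `F` is generated by its global sections. -/
def SectionSheaf.GloballyGenerated (F : SectionSheaf.{u, v} d V) : Prop :=
  F.GeneratedBy (F.sections ⊤)

/-! ### The tautological sheaf and the sheaves built from it -/

variable (d V)

/-- The structure sheaf as a module over itself. -/
abbrev structureSheaf : SectionSheaf.{u, 0} d V where
  space _ := ℂ
  sections U :=
    { carrier := {s | s ∈ Reg U}
      zero_mem' := zero_mem (Reg U)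
      add_mem' := fun hs hs' => (Reg U).add_mem hs hs'
      smul_mem' := fun f _ hs => (Reg U).mul_mem f.2 hs }
  res_mem h _ hs := Reg.res_mem h hs
  mem_of_local hs := Reg.mem_of_local hs

/-- The sheaf `⋀^p K`, where `K ⊆ V ⊗ 𝒪` is the tautological sheaf, whose fibre at `Λ` is `Λ`.
A section over `U` is a choice of an element of `⋀^p Λ` for each `Λ ∈ U` such that its image in
the fixed vector space `⋀^p V` has regular coordinates. -/
abbrev extK (p : ℕ) : SectionSheaf.{u, u} d V where
  space Λ := ⋀[ℂ]^p Λ.1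
  sections U :=
    { carrier := {s | ∀ l : Module.Dual ℂ (⋀[ℂ]^p V),
        (fun Λ : U => l (exteriorPower.map p Λ.1.1.subtype (s Λ))) ∈ Reg U}
      zero_mem' := fun l => by
        have : (fun Λ : U => l (exteriorPower.map p Λ.1.1.subtype
            ((0 : ∀ Λ : U, ⋀[ℂ]^p Λ.1.1) Λ))) = 0 := by
          funext Λ; simp
        exact this ▸ zero_mem (Reg U)
      add_mem' := by
        intro s s' hs hs' l
        have := add_mem (S := Subalgebra ℂ (U → ℂ)) (hs l) (hs' l)
        convert this using 1
        funext Λ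
        simp
      smul_mem' := by
        intro f s hs l
        have := mul_mem (S := Subalgebra ℂ (U → ℂ)) f.2 (hs l)
        convert this using 1
        funext Λ
        change l (exteriorPower.map p Λ.1.1.subtype (f.1 Λ • s Λ)) = _
        simp }
  res_mem h _ hs l := Reg.res_mem h (hs l)
  mem_of_local hs l := Reg.mem_of_local fun x =>
    let ⟨W, h, hx, hW⟩ := hs x
    ⟨W, h, hx, hW l⟩

/-- The tautological sheaf `K`: a section over `U` is a choice of a vector of `Λ` for each `Λ ∈ U`
which has regular coordinates as a vector of `V`. -/
abbrev taut : SectionSheaf.{u, u} d V where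
  space Λ := Λ.1
  sections U :=
    { carrier := {s | ∀ l : Module.Dual ℂ V, (fun Λ : U => l (s Λ : V)) ∈ Reg U}
      zero_mem' := fun l => by
        have : (fun Λ : U => l (((0 : ∀ Λ : U, Λ.1.1) Λ : Λ.1.1) : V)) = 0 := by
          funext Λ; simp
        exact this ▸ zero_mem (Reg U)
      add_mem' := by
        intro s s' hs hs' l
        have := add_mem (S := Subalgebra ℂ (U → ℂ)) (hs l) (hs' l)
        convert this using 1
        funext Λ
        simp
      smul_mem' := by
        intro f s hs l
        have := mul_mem (S := Subalgebra ℂ (U → ℂ)) f.2 (hs l)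
        convert this using 1
        funext Λ
        change l ((f.1 Λ • s Λ : Λ.1.1) : V) = _
        simp }
  res_mem h _ hs l := Reg.res_mem h (hs l)
  mem_of_local hs l := Reg.mem_of_local fun x =>
    let ⟨W, h, hx, hW⟩ := hs x
    ⟨W, h, hx, hW l⟩

variable {d V}

/-- The sheaf `ℋom(⋀^p K, F)`: families of alternating `p`-linear maps `Λ^p → F.space Λ` that send
local sections of `K` to local sections of `F`. -/
abbrev homExt (p : ℕ) (F : SectionSheaf.{u, v} d V) : SectionSheaf.{u, max u v} d V where
  space Λ := Λ.1 [⋀^Fin p]→ₗ[ℂ] F.space Λ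
  sections U :=
    { carrier := {s | ∀ (W : Opens (Gr d V)) (h : W ≤ U) (k : Fin p → ∀ Λ : W, Λ.1.1),
        (∀ i, k i ∈ (taut d V).sections W) →
          (fun Λ : W => s ⟨Λ.1, h Λ.2⟩ fun i => k i Λ) ∈ F.sections W}
      zero_mem' := fun W _ _ _ => zero_mem (F.sections W)
      add_mem' := fun hs hs' W h k hk => add_mem (hs W h k hk) (hs' W h k hk)
      smul_mem' := fun f _ hs W h k hk =>
        Submodule.smul_mem _ (⟨res (F := fun _ => ℂ) h f.1, Reg.res_mem h f.2⟩ : Reg W) (hs W h k hk) }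
  res_mem h _ hs W h' k hk := hs W (h'.trans h) k hk
  mem_of_local := by
    intro U s hs W h k hk
    refine F.mem_of_local fun x => ?_
    obtain ⟨W', h', hx, hW⟩ := hs ⟨x.1, h x.2⟩
    exact ⟨W' ⊓ W, inf_le_right, ⟨hx, x.2⟩,
      hW (W' ⊓ W) inf_le_left
        (fun i => res (F := fun Λ : Gr d V => Λ.1) (inf_le_right : W' ⊓ W ≤ W) (k i))
        fun i => (taut d V).res_mem inf_le_right (hk i)⟩

/-- The functoriality of `ℋom(⋀^p K, F)` in `F`. -/
def homExtMap (p : ℕ) {F : SectionSheaf.{u, v} d V} {G : SectionSheaf.{u, v'} d V}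
    (φ : F.Hom G) : (homExt p F).Hom (homExt p G) where
  map Λ :=
    { toFun := fun a => (φ.map Λ).compAlternatingMap a
      map_add' := fun a b => by ext x; simp
      map_smul' := fun c a => by ext x; simp }
  map_mem hs W h k hk := φ.map_mem (hs W h k hk)

/-- The twist `F(1) = ℋom(𝒪(-1), F)`, where `𝒪(-1) = ⋀^d K`. -/
abbrev twist (F : SectionSheaf.{u, v} d V) : SectionSheaf.{u, max u v} d V := homExt d F

/-- The morphism `F(1) → G(1)` induced by `F → G`. -/
abbrev twistMap {F : SectionSheaf.{u, v} d V} {G : SectionSheaf.{u, v'} d V} (φ : F.Hom G) :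
    (twist F).Hom (twist G) := homExtMap d φ

variable (d V)

/-- The sheaf `⋀^p K^∨ = ℋom(⋀^p K, 𝒪)`. -/
abbrev extKDual (p : ℕ) : SectionSheaf.{u, u} d V := homExt p (structureSheaf d V)

variable {V}

/-- The global section of `𝒪(1) = (⋀^d K)^∨` defined by a linear form on `⋀^d V`, that is, by a
linear form in the Plücker coordinates. -/
def linearSection (φ : V [⋀^Fin d]→ₗ[ℂ] ℂ) :
    ∀ Λ : (⊤ : Opens (Gr d V)), Λ.1.1 [⋀^Fin d]→ₗ[ℂ] ℂ :=
  fun Λ => φ.compLinearMap Λ.1.1.subtype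

/-- The morphism `⋀^3 K → 𝒪` induced by a trilinear alternating form `w` on `V`. -/
def contraction (w : V [⋀^Fin 3]→ₗ[ℂ] ℂ) : (extK d V 3).Hom (structureSheaf d V) where
  map Λ := exteriorPower.alternatingMapLinearEquiv w ∘ₗ exteriorPower.map 3 Λ.1.subtype
  map_mem hs := hs (exteriorPower.alternatingMapLinearEquiv w)

end Sheaves

/-! ### The nullspaces of a semisimple Lie algebra -/

section Lie

variable (𝔤 : Type u) [LieRing 𝔤] [LieAlgebra ℂ 𝔤]

/-- The invariant alternating trilinear form `w(x, y, z) = κ([x, y], z)`, with `κ` the Killing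
form. -/
def cartanForm : 𝔤 [⋀^Fin 3]→ₗ[ℂ] ℂ where
  toFun x := killingForm ℂ 𝔤 ⁅x 0, x 1⁆ (x 2)
  map_update_add' := by
    intro inst x i a b
    obtain rfl : inst = instDecidableEqFin 3 := Subsingleton.elim _ _
    fin_cases i <;> simp [Function.update]
  map_update_smul' := by
    intro inst x i c a
    obtain rfl : inst = instDecidableEqFin 3 := Subsingleton.elim _ _
    fin_cases i <;> simp [Function.update]
  map_eq_zero_of_eq' := by
    intro x i j hij hne
    have key : ∀ a b c : 𝔤, killingForm ℂ 𝔤 ⁅a, b⁆ c = killingForm ℂ 𝔤 a ⁅b, c⁆ :=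
      LieModule.traceForm_apply_lie_apply ℂ 𝔤 𝔤
    have key' : ∀ a b : 𝔤, killingForm ℂ 𝔤 a ⁅b, a⁆ = 0 := fun a b => by
      rw [LieModule.traceForm_comm, key, lie_self, map_zero]
    fin_cases i <;> fin_cases j <;> simp_all

variable {𝔤}

/-- A nullspace: a subspace on which `w` vanishes identically. -/
def IsNullspace (W : Submodule ℂ 𝔤) : Prop :=
  ∀ x ∈ W, ∀ y ∈ W, ∀ z ∈ W, killingForm ℂ 𝔤 ⁅x, y⁆ z = 0

/-- A maximal nullspace: a nullspace of maximal dimension. -/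
def IsMaximalNullspace (W : Submodule ℂ 𝔤) : Prop :=
  IsNullspace W ∧ ∀ W' : Submodule ℂ 𝔤, IsNullspace W' →
    Module.finrank ℂ W' ≤ Module.finrank ℂ W

variable (d : ℕ) (𝔤)

/-- The ideal sheaf `I_Y`: the image of the morphism `⋀^3 K → 𝒪` induced by `w`. -/
abbrev idealY : SectionSheaf.{u, 0} d 𝔤 := (contraction d (cartanForm 𝔤)).image

/-- The surjection `⋀^3 K → I_Y`. -/
def toIdealY : (extK d 𝔤 3).Hom (idealY 𝔤 d) := (contraction d (cartanForm 𝔤)).toImage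

/-- The zero locus of the ideal sheaf `I_Y`: the points where all its local sections vanish. -/
def zeroLocusY : Set (Gr d 𝔤) :=
  {Λ | ∀ (U : Opens (Gr d 𝔤)) (h : Λ ∈ U), ∀ f ∈ (idealY 𝔤 d).sections U, f ⟨Λ, h⟩ = (0 : ℂ)}

/-- The linear equations of `Y`: the linear forms on `⋀^d 𝔤` that define global sections of
`I_Y(1) ⊆ 𝒪(1)`. -/
def linearEquations : Set (𝔤 [⋀^Fin d]→ₗ[ℂ] ℂ) :=
  {φ | linearSection d φ ∈ (twist (idealY 𝔤 d)).sections ⊤}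

end Lie

end NullGr

end

/-! Everything reduces to linear algebra on one subspace `Λ` of dimension `m + p`, done with
formulas whose coefficients are regular in `Λ`. An `m`-form `β` on `Λ` gives the alternating map
`altProd (ιMulti) β` from `Λ^(m+p)` to `⋀^p Λ`: split the arguments, feed `m` of them to `β`, wedge
the other `p`, antisymmetrize. Pairing the result with the wedge of `p` members of a dual basis
returns a nonzero multiple of `β` on the complementary `m` basis vectors (`altProd_wedgeForms`).
Hence the map is injective, and bijective by a dimension count. The same formula shows that it
preserves and reflects regularity, so it is an isomorphism of sheaves (`twistExtKIso`).

The sheaf `K` has local frames whose dual frames are restrictions of fixed linear forms on `V`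
(`coordFrame`, by Cramer's rule). Expanding along such a frame shows that `⋀^m K^∨` is generated by
restrictions of `m`-forms `α` on `V` (`extKDual_generatedBy`); the isomorphism carries these
generators to `⋀^p K(1)`.

For `p = 3`, contraction with `w` commutes with the product, so the generator attached to `α` goes
to the restriction of the fixed form `altProd w α`, a linear form in the Plücker coordinates
(`linearSection_altProd`). Twisting by a line bundle preserves surjectivity onto the image, so these
forms generate `I_Y(1)`. A point lies in `Y` exactly when `w` vanishes on `Λ`, because every vector
of `Λ` extends to a local section of `K`. If `d < 3`, then `⋀^3 K = 0` and the empty set generates.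
-/

noncomputable section

namespace NullGr

/-! ### Alternating maps -/

section Alternating

variable {E : Type*} [AddCommGroup E] [Module ℂ E] {E' : Type*} [AddCommGroup E'] [Module ℂ E']
  {N : Type*} [AddCommGroup N] [Module ℂ N] {N' : Type*} [AddCommGroup N'] [Module ℂ N']

/-- The exterior product of linear forms, as an alternating form. -/
def wedgeForms {p : ℕ} (ξ : Fin p → Module.Dual ℂ E) : E [⋀^Fin p]→ₗ[ℂ] ℂ :=
  Matrix.detRowAlternating.compLinearMap (LinearMap.pi ξ)

theorem wedgeForms_apply {p : ℕ} (ξ : Fin p → Module.Dual ℂ E) (x : Fin p → E) :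
    wedgeForms ξ x = (Matrix.of fun i j => ξ j (x i)).det := rfl

theorem wedgeForms_apply_eq_one {p : ℕ} {ξ : Fin p → Module.Dual ℂ E} {e : Fin p → E}
    (h : ∀ i j, ξ i (e j) = if i = j then 1 else 0) : wedgeForms ξ e = 1 := by
  rw [wedgeForms_apply, ← Matrix.det_one (n := Fin p)]
  congr 1
  ext i j
  simp [h, Matrix.one_apply, eq_comm]

/-- Expansion of a multilinear map along a family `e` with coordinate functions `ξ`. -/
theorem multilinear_expand {ι κ : Type*} [Fintype ι] [DecidableEq ι] [Fintype κ]
    (M : MultilinearMap ℂ (fun _ : ι => E) N) {ξ : κ → Module.Dual ℂ E} {e : κ → E}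
    {x : ι → E} (h : ∀ i, ∑ k, ξ k (x i) • e k = x i) :
    M x = ∑ f : ι → κ, (∏ i, ξ (f i) (x i)) • M fun i => e (f i) := by
  conv_lhs => rw [← funext h]
  rw [MultilinearMap.map_sum]
  exact Finset.sum_congr rfl fun f _ => M.map_smul_univ _ _

/-- Expansion of an alternating form along a basis. -/
theorem alternating_expand {p : ℕ} {κ : Type*} [Fintype κ] (β : E [⋀^Fin p]→ₗ[ℂ] N)
    {ξ : κ → Module.Dual ℂ E} {e : κ → E} {x : Fin p → E} (h : ∀ i, ∑ k, ξ k (x i) • e k = x i) :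
    (p.factorial : ℂ) • β x =
      ∑ f : Fin p → κ, wedgeForms (fun i => ξ (f i)) x • β fun i => e (f i) := by
  -- Expanding `β (x ∘ σ)` and correcting by the sign of `σ` gives `β x` for every `σ`. Summing over
  -- `σ` produces `p!` on the left and the Leibniz formula for determinants on the right.
  have key : ∀ σ : Equiv.Perm (Fin p),
      β x = ∑ f : Fin p → κ, ((Equiv.Perm.sign σ : ℤ) : ℂ) • (∏ i, ξ (f i) (x (σ i))) •
        β fun i => e (f i) := by
    intro σ
    rw [← Finset.smul_sum]
    have := multilinear_expand (M := β.toMultilinearMap) (x := fun i => x (σ i)) fun i => h (σ i)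
    rw [AlternatingMap.coe_multilinearMap] at this
    rw [← this]
    have hp := β.map_perm x σ
    rw [Function.comp_def] at hp
    rw [hp, Units.smul_def, ← Int.cast_smul_eq_zsmul ℂ, smul_smul]
    norm_cast
    simp
  have hs : (p.factorial : ℂ) • β x = ∑ _σ : Equiv.Perm (Fin p), β x := by
    rw [Finset.sum_const, Finset.card_univ, Fintype.card_perm, Fintype.card_fin,
      Nat.cast_smul_eq_nsmul]
  rw [hs, Finset.sum_congr rfl fun σ _ => key σ, Finset.sum_comm]
  refine Finset.sum_congr rfl fun f _ => ?_
  simp_rw [smul_smul]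
  rw [← Finset.sum_smul, wedgeForms_apply, Matrix.det_apply']
  rfl

/-- The basis given by a finite family with its coordinate functions. -/
def dualPairBasis {κ : Type*} [Fintype κ] [DecidableEq κ] {ξ : κ → Module.Dual ℂ E} {e : κ → E}
    (h : ∀ i j, ξ i (e j) = if i = j then 1 else 0) (hx : ∀ x, ∑ k, ξ k x • e k = x) :
    Module.Basis κ ℂ E :=
  Module.Basis.ofEquivFun
    { LinearMap.pi ξ with
      invFun := fun c => ∑ k, c k • e k
      left_inv := hx
      right_inv := fun c => by
        funext i
        simp [h] }

theorem dualPairBasis_apply {κ : Type*} [Fintype κ] [DecidableEq κ] {ξ : κ → Module.Dual ℂ E}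
    {e : κ → E} (h : ∀ i j, ξ i (e j) = if i = j then 1 else 0)
    (hx : ∀ x, ∑ k, ξ k x • e k = x) (i : κ) : dualPairBasis h hx i = e i := by
  rw [dualPairBasis, Module.Basis.coe_ofEquivFun]
  change ∑ k, (Pi.single i (1 : ℂ) : κ → ℂ) k • e k = e i
  simp [Pi.single_apply]

/-- An alternating map of top degree is determined by its value on a basis. -/
theorem alternating_top_expand {p : ℕ} {ξ : Fin p → Module.Dual ℂ E} {e : Fin p → E}
    (h : ∀ i j, ξ i (e j) = if i = j then 1 else 0) (hx : ∀ x, ∑ k, ξ k x • e k = x)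
    (a : E [⋀^Fin p]→ₗ[ℂ] N) (x : Fin p → E) : a x = wedgeForms ξ x • a e := by
  have key : a = (LinearMap.toSpanSingleton ℂ N (a e)).compAlternatingMap (wedgeForms ξ) := by
    refine (dualPairBasis h hx).ext_alternating fun f hf => ?_
    simp only [dualPairBasis_apply]
    let σ : Equiv.Perm (Fin p) := Equiv.ofBijective f (Finite.injective_iff_bijective.1 hf)
    have h1 := a.map_perm e σ
    have h2 := (wedgeForms ξ).map_perm e σ
    rw [wedgeForms_apply_eq_one h] at h2
    simp only [Function.comp_def, σ, Equiv.ofBijective_apply] at h1 h2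
    simp [h1, h2, Units.smul_def, ← Int.cast_smul_eq_zsmul ℂ]
  conv_lhs => rw [key]
  rfl

/-- The bijection under which the first `m` indices come from the second summand. -/
def blockEquiv (m p : ℕ) : Fin p ⊕ Fin m ≃ Fin (m + p) :=
  (Equiv.sumComm _ _).trans finSumFinEquiv

@[simp] theorem blockEquiv_inl (m p : ℕ) (j : Fin p) :
    blockEquiv m p (Sum.inl j) = Fin.natAdd m j := by simp [blockEquiv]

@[simp] theorem blockEquiv_inr (m p : ℕ) (i : Fin m) :
    blockEquiv m p (Sum.inr i) = Fin.castAdd p i := by simp [blockEquiv]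

/-- The product of an alternating map and an alternating form, antisymmetrized over all
permutations. -/
def altProd {m p : ℕ} (a : E [⋀^Fin p]→ₗ[ℂ] N) :
    (E [⋀^Fin m]→ₗ[ℂ] ℂ) →ₗ[ℂ] E [⋀^Fin (m + p)]→ₗ[ℂ] N where
  toFun β := MultilinearMap.alternatization
    (((TensorProduct.rid ℂ N).toLinearMap.compMultilinearMap
      (a.toMultilinearMap.domCoprod β.toMultilinearMap)).domDomCongr (blockEquiv m p))
  map_add' β β' := by
    ext v
    simp [MultilinearMap.alternatization_apply, add_smul, Finset.sum_add_distrib]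
  map_smul' c β := by
    ext v
    simp [MultilinearMap.alternatization_apply, mul_smul, Finset.smul_sum, smul_comm _ c]

/-- The sum runs over all permutations, not over shuffles, so each shuffle is counted with a
multiplicity, which reappears as `(blockPerms m p).card`. In characteristic zero this is harmless.
-/
theorem altProd_apply {m p : ℕ} (a : E [⋀^Fin p]→ₗ[ℂ] N) (β : E [⋀^Fin m]→ₗ[ℂ] ℂ)
    (v : Fin (m + p) → E) :
    altProd a β v = ∑ σ : Equiv.Perm (Fin (m + p)), ((Equiv.Perm.sign σ : ℤ) : ℂ) •
      (β fun i => v (σ (Fin.castAdd p i))) • a fun j => v (σ (Fin.natAdd m j)) := by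
  simp [altProd, MultilinearMap.alternatization_apply, Units.smul_def, ← Int.cast_smul_eq_zsmul ℂ]

/-- This lets a linear form on `⋀^p`, either a dual wedge or the contraction with `w`, be moved
inside the product. -/
theorem compAlternatingMap_altProd {m p : ℕ} (g : N →ₗ[ℂ] N') (a : E [⋀^Fin p]→ₗ[ℂ] N)
    (β : E [⋀^Fin m]→ₗ[ℂ] ℂ) :
    g.compAlternatingMap (altProd a β) = altProd (g.compAlternatingMap a) β := by
  ext v
  simp [altProd_apply]

theorem altProd_compLinearMap {m p : ℕ} (g : E' →ₗ[ℂ] E) (a : E [⋀^Fin p]→ₗ[ℂ] N)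
    (β : E [⋀^Fin m]→ₗ[ℂ] ℂ) :
    (altProd a β).compLinearMap g = altProd (a.compLinearMap g) (β.compLinearMap g) := by
  ext v
  simp [altProd_apply]

/-- The permutations that preserve the last `p` indices. -/
def blockPerms (m p : ℕ) : Finset (Equiv.Perm (Fin (m + p))) :=
  Finset.univ.filter fun σ => ∀ j : Fin p, ∃ j' : Fin p, σ (Fin.natAdd m j) = Fin.natAdd m j'

theorem card_blockPerms_ne_zero (m p : ℕ) : ((blockPerms m p).card : ℂ) ≠ 0 :=
  Nat.cast_ne_zero.2 <| Finset.card_ne_zero.2 ⟨1, by simp [blockPerms]⟩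

/-- A permutation preserving the last block is a product of permutations of the two blocks. -/
theorem exists_of_mem_blockPerms {m p : ℕ} {σ : Equiv.Perm (Fin (m + p))}
    (h : σ ∈ blockPerms m p) : ∃ (τ : Equiv.Perm (Fin p)) (ρ : Equiv.Perm (Fin m)),
      Equiv.Perm.sign σ = Equiv.Perm.sign τ * Equiv.Perm.sign ρ ∧
      (∀ j, σ (Fin.natAdd m j) = Fin.natAdd m (τ j)) ∧
      ∀ i, σ (Fin.castAdd p i) = Fin.castAdd p (ρ i) := by
  have hσ : Set.MapsTo ((blockEquiv m p).symm.permCongr σ) (Set.range Sum.inl)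
      (Set.range Sum.inl) := by
    rintro _ ⟨j, rfl⟩
    obtain ⟨j', hj'⟩ := (Finset.mem_filter.1 h).2 j
    refine ⟨j', ?_⟩
    rw [Equiv.permCongr_apply, Equiv.symm_symm, blockEquiv_inl, hj', ← blockEquiv_inl,
      Equiv.symm_apply_apply]
  obtain ⟨⟨τ, ρ⟩, hτ⟩ := Equiv.Perm.mem_sumCongrHom_range_of_perm_mapsTo_inl hσ
  have hval : ∀ x, σ (blockEquiv m p x) = blockEquiv m p (Sum.map τ ρ x) := by
    intro x
    have := congrArg (fun π => blockEquiv m p (π x)) hτ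
    simpa [Equiv.permCongr_apply] using this.symm
  refine ⟨τ, ρ, ?_, fun j => by simpa using hval (Sum.inl j),
    fun i => by simpa using hval (Sum.inr i)⟩
  rw [← Equiv.Perm.sign_sumCongr, ← Equiv.Perm.sign_permCongr (blockEquiv m p).symm σ, ← hτ]
  rfl

/-- The value of the product with a dual form recovers the value of the other factor. -/
theorem altProd_wedgeForms {m p : ℕ} {ξ : Fin (m + p) → Module.Dual ℂ E} {e : Fin (m + p) → E}
    (h : ∀ i j, ξ i (e j) = if i = j then 1 else 0) (β : E [⋀^Fin m]→ₗ[ℂ] ℂ) :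
    altProd (wedgeForms fun j : Fin p => ξ (Fin.natAdd m j)) β e =
      (blockPerms m p).card * β fun i => e (Fin.castAdd p i) := by
  rw [altProd_apply, ← Finset.sum_subset (Finset.subset_univ (blockPerms m p)), ← nsmul_eq_mul,
    ← Finset.sum_const]
  · refine Finset.sum_congr rfl fun σ hσ => ?_
    obtain ⟨τ, ρ, hs, hτ, hρ⟩ := exists_of_mem_blockPerms hσ
    have hβ := β.map_perm (fun i => e (Fin.castAdd p i)) ρ
    have hw := (wedgeForms fun j : Fin p => ξ (Fin.natAdd m j)).map_perm
      (fun j => e (Fin.natAdd m j)) τ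
    rw [wedgeForms_apply_eq_one (e := fun j => e (Fin.natAdd m j)) fun i j => by simp [h]] at hw
    simp only [Function.comp_def] at hβ hw
    simp only [hτ, hρ, hβ, hw, hs, Units.smul_def, zsmul_eq_mul, smul_eq_mul]
    -- In each surviving term the signs of `τ` and `ρ` occur twice, once from `σ` and once from
    -- reordering the arguments, and so cancel.
    have h1 : (((Equiv.Perm.sign τ : ℤ) : ℂ)) * ((Equiv.Perm.sign τ : ℤ) : ℂ) = 1 := by
      norm_cast; simp
    have h2 : (((Equiv.Perm.sign ρ : ℤ) : ℂ)) * ((Equiv.Perm.sign ρ : ℤ) : ℂ) = 1 := by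
      norm_cast; simp
    push_cast
    linear_combination (β fun i => e (Fin.castAdd p i)) *
      (h1 * ((Equiv.Perm.sign ρ : ℤ) : ℂ) * ((Equiv.Perm.sign ρ : ℤ) : ℂ) + h2)
  · intro σ _ hσ
    simp only [blockPerms, Finset.mem_filter, Finset.mem_univ, true_and, not_forall,
      not_exists] at hσ
    obtain ⟨j, hj⟩ := hσ
    -- If `σ` sends some last-block index `j` out of that block, all the forms of the block vanish
    -- on the corresponding vector.
    rw [wedgeForms_apply, Matrix.det_eq_zero_of_row_eq_zero j, smul_zero, smul_zero]
    intro j'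
    simp [h, Ne.symm (hj j')]

/-- An injection of the first `m` indices extends to a permutation. -/
theorem exists_perm_castAdd {m p : ℕ} {f : Fin m → Fin (m + p)} (hf : Function.Injective f) :
    ∃ σ : Equiv.Perm (Fin (m + p)), ∀ i, σ (Fin.castAdd p i) = f i := by
  let ε := (Equiv.ofInjective _ (Fin.castAdd_injective m p)).symm.trans (Equiv.ofInjective f hf)
  refine ⟨ε.extendSubtype, fun i => ?_⟩
  rw [Equiv.extendSubtype_apply_of_mem ε _ ⟨i, rfl⟩]
  have : (Equiv.ofInjective _ (Fin.castAdd_injective m p)).symm ⟨Fin.castAdd p i, ⟨i, rfl⟩⟩ = i :=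
    Equiv.ofInjective_symm_apply _ i
  simp [ε, this]

/-- `altProd_wedgeForms` for an arbitrary choice of `m` of the basis vectors. -/
theorem altProd_wedgeForms_perm {m p : ℕ} {ξ : Fin (m + p) → Module.Dual ℂ E}
    {e : Fin (m + p) → E} (h : ∀ i j, ξ i (e j) = if i = j then 1 else 0)
    (σ : Equiv.Perm (Fin (m + p))) (β : E [⋀^Fin m]→ₗ[ℂ] ℂ) :
    altProd (wedgeForms fun j : Fin p => ξ (σ (Fin.natAdd m j))) β (fun i => e (σ i)) =
      (blockPerms m p).card * β fun i => e (σ (Fin.castAdd p i)) :=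
  altProd_wedgeForms (ξ := fun i => ξ (σ i)) (e := fun i => e (σ i)) (fun i j => by simp [h]) β

/-- Given `m` distinct basis vectors, composing with the wedge of the complementary dual basis
vectors extracts a nonzero multiple of the value of `β` on them; if the product is zero, all these
values are zero. -/
theorem altProd_ιMulti_injective {m p : ℕ} [Module.Finite ℂ E]
    (hE : Module.finrank ℂ E = m + p) :
    Function.Injective (altProd (m := m) (exteriorPower.ιMulti ℂ p (M := E))) := by
  rw [injective_iff_map_eq_zero]
  intro β hβ
  let b := (Module.finBasis ℂ E).reindex (finCongr hE)
  refine b.ext_alternating fun f hf => ?_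
  obtain ⟨σ, hσ⟩ := exists_perm_castAdd hf
  have h := altProd_wedgeForms_perm (ξ := b.coord) (e := b)
    (fun i j => by simp [Finsupp.single_apply, eq_comm]) σ β
  have h0 := compAlternatingMap_altProd (exteriorPower.alternatingMapLinearEquiv
    (wedgeForms fun j : Fin p => b.coord (σ (Fin.natAdd m j)))) (exteriorPower.ιMulti ℂ p) β
  rw [exteriorPower.alternatingMapLinearEquiv_comp_ιMulti, hβ] at h0
  rw [← h0] at h
  simp only [hσ] at h
  exact (mul_eq_zero.1 (h.symm.trans (by simp))).resolve_left (card_blockPerms_ne_zero m p)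

/-- The isomorphism between `⋀^m E^∨` and `Hom(⋀^(m+p) E, ⋀^p E)` for `E` of dimension `m + p`. -/
def altProdEquiv (m p : ℕ) [Module.Finite ℂ E] (hE : Module.finrank ℂ E = m + p) :
    (E [⋀^Fin m]→ₗ[ℂ] ℂ) ≃ₗ[ℂ] E [⋀^Fin (m + p)]→ₗ[ℂ] ⋀[ℂ]^p E :=
  haveI : Module.Finite ℂ (E [⋀^Fin m]→ₗ[ℂ] ℂ) :=
    Module.Finite.equiv exteriorPower.alternatingMapLinearEquiv.symm
  haveI : Module.Finite ℂ (E [⋀^Fin (m + p)]→ₗ[ℂ] ⋀[ℂ]^p E) :=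
    Module.Finite.equiv exteriorPower.alternatingMapLinearEquiv.symm
  LinearEquiv.ofInjectiveOfFinrankEq (altProd (exteriorPower.ιMulti ℂ p))
    (altProd_ιMulti_injective hE) <| by
      -- The dimensions are `(m + p).choose m` and `(m + p).choose p`, since the top exterior power
      -- is a line.
      rw [exteriorPower.alternatingMapLinearEquiv.finrank_eq,
        exteriorPower.alternatingMapLinearEquiv.finrank_eq, Module.finrank_linearMap,
        Module.finrank_linearMap, exteriorPower.finrank_eq, exteriorPower.finrank_eq,
        exteriorPower.finrank_eq, hE, Module.finrank_self, Nat.choose_self, mul_one, one_mul,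
        Nat.choose_symm_add]

end Alternating

/-! ### Generation of sheaves by sections -/

section Generation

variable {d : ℕ} {V : Type u} [AddCommGroup V] [Module ℂ V]

/-- The action of a morphism on all families of elements of the fibres. -/
def SectionSheaf.Hom.onFamilies {F : SectionSheaf.{u, v} d V} {G : SectionSheaf.{u, v'} d V}
    (φ : F.Hom G) (W : Opens (Gr d V)) :
    (∀ Λ : W, F.space Λ) →ₗ[Reg W] ∀ Λ : W, G.space Λ where
  toFun s Λ := φ.map Λ (s Λ)
  map_add' _ _ := funext fun Λ => map_add (φ.map Λ) _ _
  map_smul' f s := funext fun Λ => map_smul (φ.map Λ) (f.1 Λ) (s Λ)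

theorem SectionSheaf.GeneratedBy.globallyGenerated {F : SectionSheaf.{u, v} d V}
    {S : Set (∀ Λ : (⊤ : Opens (Gr d V)), F.space Λ)} (hS : F.GeneratedBy S) :
    F.GloballyGenerated := by
  refine ⟨subset_rfl, fun U s hs x => ?_⟩
  obtain ⟨W, h, hx, hW⟩ := hS.2 U s hs x
  exact ⟨W, h, hx, Submodule.span_mono (Set.image_mono hS.1) hW⟩

theorem SectionSheaf.GeneratedBy.mono {F : SectionSheaf.{u, v} d V}
    {S T : Set (∀ Λ : (⊤ : Opens (Gr d V)), F.space Λ)} (hS : F.GeneratedBy S) (hST : S ⊆ T)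
    (hT : T ⊆ F.sections ⊤) : F.GeneratedBy T := by
  refine ⟨hT, fun U s hs x => ?_⟩
  obtain ⟨W, h, hx, hW⟩ := hS.2 U s hs x
  exact ⟨W, h, hx, Submodule.span_mono (Set.image_mono hST) hW⟩

/-- The image of a generating set under a surjective morphism is generating. -/
theorem SectionSheaf.GeneratedBy.map {F : SectionSheaf.{u, v} d V} {G : SectionSheaf.{u, v'} d V}
    {φ : F.Hom G} (hφ : φ.IsSurjective) {S : Set (∀ Λ : (⊤ : Opens (Gr d V)), F.space Λ)}
    (hS : F.GeneratedBy S) : G.GeneratedBy (φ.onFamilies ⊤ '' S) := by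
  refine ⟨?_, fun U s hs x => ?_⟩
  · rintro _ ⟨s, hs, rfl⟩
    exact φ.map_mem (hS.1 hs)
  · obtain ⟨W, h, hx, t, ht, e⟩ := hφ U s hs x
    obtain ⟨W', h', hx', hW'⟩ := hS.2 W t ht ⟨x.1, hx⟩
    refine ⟨W', h'.trans h, hx', ?_⟩
    have hmem := Submodule.mem_map_of_mem (f := φ.onFamilies W') hW'
    rw [Submodule.map_span, Set.image_image] at hmem
    rw [Set.image_image]
    have e' : res (h'.trans h) s = φ.onFamilies W' (res h' t) := by
      rw [show res (h'.trans h) s = res h' (res h s) from rfl, ← e]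
      rfl
    rw [e']
    exact hmem

/-- The inverse of an isomorphism, as a morphism. -/
def SectionSheaf.Iso.inv {F : SectionSheaf.{u, v} d V} {G : SectionSheaf.{u, v'} d V}
    (ε : F.Iso G) : G.Hom F where
  map Λ := (ε.equiv Λ).symm
  map_mem hs := ε.mem_iff.2 (by simpa using hs)

theorem SectionSheaf.Iso.inv_isSurjective {F : SectionSheaf.{u, v} d V}
    {G : SectionSheaf.{u, v'} d V} (ε : F.Iso G) : ε.inv.IsSurjective := fun U s hs x =>
  ⟨U, le_rfl, x.2, _, ε.mem_iff.1 hs, funext fun Λ => (ε.equiv Λ.1).symm_apply_apply (s Λ)⟩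

end Generation

/-! ### Local frames of the tautological sheaf -/

section Frames

variable {d : ℕ} {V : Type u} [AddCommGroup V] [Module ℂ V]

/-- A frame of the tautological sheaf over `W` whose dual frame is the restriction of linear forms
on `V`. -/
structure LocalFrame (W : Opens (Gr d V)) where
  form : Fin d → Module.Dual ℂ V
  vec : Fin d → ∀ Λ : W, Λ.1.1
  vec_mem : ∀ i, vec i ∈ (taut d V).sections W
  form_vec : ∀ (Λ : W) (i j : Fin d), form i (vec j Λ : V) = if i = j then 1 else 0

/-- The coordinates of a vector of `Λ` given by a system of `d` linear forms on `V`. -/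
def coordMap (ξ : Fin d → Module.Dual ℂ V) (Λ : Gr d V) : Λ.1 →ₗ[ℂ] Fin d → ℂ :=
  LinearMap.pi ξ ∘ₗ Λ.1.subtype

theorem coordMap_injective_iff {ξ : Fin d → Module.Dual ℂ V} {Λ : Gr d V} :
    Function.Injective (coordMap ξ Λ) ↔ Function.Surjective (coordMap ξ Λ) := by
  have := Λ.2.1
  exact LinearMap.injective_iff_surjective_of_finrank_eq_finrank (by simp [Λ.2.2])

namespace LocalFrame

variable {W : Opens (Gr d V)} (F : LocalFrame W)

theorem form_comp_vec (Λ : W) (i j : Fin d) :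
    (F.form i ∘ₗ Λ.1.1.subtype) (F.vec j Λ) = if i = j then 1 else 0 := F.form_vec Λ i j

theorem sum_form_smul_vec (Λ : W) (x : Λ.1.1) :
    ∑ i, (F.form i ∘ₗ Λ.1.1.subtype) x • F.vec i Λ = x := by
  -- Duality makes the coordinate map surjective, hence injective by equality of dimensions; the two
  -- sides have the same coordinates.
  have hform : ∀ c : Fin d → ℂ, coordMap F.form Λ.1 (∑ i, c i • F.vec i Λ) = c := fun c => by
    funext j
    simp [coordMap, F.form_vec]
  exact coordMap_injective_iff.2 (fun c => ⟨_, hform c⟩) (hform _)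

/-- The restriction of a frame to a smaller open set. -/
def restrict {W' : Opens (Gr d V)} (h : W' ≤ W) : LocalFrame W' where
  form := F.form
  vec i := res (F := fun Λ : Gr d V => Λ.1) h (F.vec i)
  vec_mem i := (taut d V).res_mem h (F.vec_mem i)
  form_vec Λ := F.form_vec ⟨Λ.1, h Λ.2⟩

/-- Every vector of a fibre is the value of a section of the tautological sheaf. -/
theorem exists_section (F : LocalFrame W) (Λ : W) (x : Λ.1.1) : ∃ k ∈ (taut d V).sections W, k Λ = x := by
  refine ⟨fun Λ' => ∑ i, (F.form i ∘ₗ Λ.1.1.subtype) x • F.vec i Λ', fun l => ?_,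
    F.sum_form_smul_vec Λ x⟩
  have : (fun Λ' : W => l ((∑ i, (F.form i ∘ₗ Λ.1.1.subtype) x • F.vec i Λ' : Λ'.1.1) : V)) =
      ∑ i, (F.form i ∘ₗ Λ.1.1.subtype) x • fun Λ' : W => l (F.vec i Λ' : V) := by
    funext Λ'
    simp
  rw [this]
  exact sum_mem fun i _ => Subalgebra.smul_mem _ (F.vec_mem i l) _

end LocalFrame

theorem IsFrame.mem {Λ : Gr d V} {v : Fin d → V} (hv : IsFrame Λ v) (i : Fin d) : v i ∈ Λ.1 :=
  hv.2 ▸ Submodule.subset_span ⟨i, rfl⟩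

/-- The exterior product of `ξ` does not vanish on the bases of `Λ` if and only if `ξ` restricts to
a coordinate system on `Λ`. -/
theorem wedgeForms_ne_zero_iff {ξ : Fin d → Module.Dual ℂ V} {Λ : Gr d V} {v : Fin d → V}
    (hv : IsFrame Λ v) : wedgeForms ξ v ≠ 0 ↔ Function.Injective (coordMap ξ Λ) := by
  have hdet : wedgeForms ξ v ≠ 0 ↔ LinearIndependent ℂ fun i => coordMap ξ Λ ⟨v i, hv.mem i⟩ := by
    rw [wedgeForms_apply, ← isUnit_iff_ne_zero, ← Matrix.isUnit_iff_isUnit_det,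
      ← Matrix.linearIndependent_rows_iff_isUnit]
    rfl
  have hind : LinearIndependent ℂ fun i => (⟨v i, hv.mem i⟩ : Λ.1) :=
    LinearIndependent.of_comp Λ.1.subtype hv.1
  rw [hdet]
  refine ⟨fun h => ?_, fun h => hind.map' _ (LinearMap.ker_eq_bot.2 h)⟩
  rw [coordMap_injective_iff, ← LinearMap.range_eq_top, eq_top_iff,
    ← h.span_eq_top_of_card_eq_finrank' (by simp), Submodule.span_le]
  rintro _ ⟨i, rfl⟩
  exact ⟨_, rfl⟩

/-- `nonvanishing` quantifies over all bases of `Λ`, so a basis must exist for membership to carry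
information. -/
theorem exists_isFrame (Λ : Gr d V) : ∃ v, IsFrame Λ v := by
  have := Λ.2.1
  let b := (Module.finBasis ℂ Λ.1).reindex (finCongr Λ.2.2)
  refine ⟨fun i => b i, b.linearIndependent.map' Λ.1.subtype (Submodule.ker_subtype _), ?_⟩
  have := congrArg (Submodule.map Λ.1.subtype) b.span_eq
  rw [Submodule.map_span, ← Set.range_comp, Submodule.map_top, Submodule.range_subtype] at this
  exact this

/-- The open set of the subspaces on which `ξ` restricts to a coordinate system. -/
def coordOpen (ξ : Fin d → Module.Dual ℂ V) : Opens (Gr d V) where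
  carrier := {Λ | Function.Injective (coordMap ξ Λ)}
  is_open' := by
    refine TopologicalSpace.isOpen_generateFrom_of_mem
      ⟨1, MvPolynomial.X (wedgeForms ξ), MvPolynomial.isHomogeneous_X _ _, ?_⟩
    ext Λ
    obtain ⟨v, hv⟩ := exists_isFrame Λ
    simp only [Set.mem_ofPred_eq, nonvanishing, pluckerEval, MvPolynomial.eval_X]
    exact ⟨fun h v hv => (wedgeForms_ne_zero_iff hv).2 h,
      fun h => (wedgeForms_ne_zero_iff hv).1 (h v hv)⟩

/-- The vectors of `Λ` dual to the coordinates `ξ`. -/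
def coordVec (ξ : Fin d → Module.Dual ℂ V) (i : Fin d) (Λ : coordOpen ξ) : Λ.1.1 :=
  (LinearEquiv.ofBijective (coordMap ξ Λ.1) ⟨Λ.2, coordMap_injective_iff.1 Λ.2⟩).symm
    (Pi.single i 1)

theorem form_coordVec (ξ : Fin d → Module.Dual ℂ V) (Λ : coordOpen ξ) (i j : Fin d) :
    ξ i (coordVec ξ j Λ : V) = if i = j then 1 else 0 := by
  have := congrFun ((LinearEquiv.ofBijective (coordMap ξ Λ.1)
    ⟨Λ.2, coordMap_injective_iff.1 Λ.2⟩).apply_symm_apply (Pi.single j 1)) i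
  rw [Pi.single_apply] at this
  exact this

/-- Cramer's rule for the coordinates of the dual vectors. -/
theorem wedgeForms_update {ξ : Fin d → Module.Dual ℂ V} (Λ : coordOpen ξ) {v : Fin d → V}
    (hv : ∀ i, v i ∈ Λ.1.1) (l : Module.Dual ℂ V) (j : Fin d) :
    wedgeForms (Function.update ξ j l) v = l (coordVec ξ j Λ : V) * wedgeForms ξ v := by
  set A : Matrix (Fin d) (Fin d) ℂ := Matrix.of fun i k => ξ k (v i) with hA
  set b : Fin d → ℂ := fun k => l (coordVec ξ k Λ : V) with hb
  -- Expanding `v i` in the dual vectors shows that the column replacing column `j` of `A` is `A b`;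
  -- Cramer's rule then gives `b j * det A`.
  have hexp : ∀ i, l (v i) = (A.mulVec b) i := fun i => by
    have hinj : (⟨v i, hv i⟩ : Λ.1.1) = ∑ k, ξ k (v i) • coordVec ξ k Λ := by
      apply Λ.2
      funext k
      simp [coordMap, form_coordVec]
    have := congrArg (fun x : Λ.1.1 => l (x : V)) hinj
    simpa [Matrix.mulVec, dotProduct, hA, hb] using this
  have hup : (Matrix.of fun i k => Function.update ξ j l k (v i)) =
      A.updateCol j (A.mulVec b) := by
    ext i k
    rw [Matrix.updateCol_apply]
    split_ifs with hk
    · subst hk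
      simp [← hexp]
    · simp [Function.update_of_ne hk, hA]
  rw [wedgeForms_apply, hup, ← Matrix.cramer_apply, Matrix.cramer_eq_adjugate_mulVec,
    Matrix.mulVec_mulVec, Matrix.adjugate_mul, Matrix.smul_mulVec, Matrix.one_mulVec,
    wedgeForms_apply, Pi.smul_apply, smul_eq_mul, mul_comm]

/-- The frame of the tautological sheaf dual to `ξ`. -/
def coordFrame (ξ : Fin d → Module.Dual ℂ V) : LocalFrame (coordOpen ξ) where
  form := ξ
  vec := coordVec ξ
  vec_mem j l x := by
    -- By Cramer's rule, `l` of the `j`-th dual vector is a quotient of two Plücker coordinates,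
    -- hence the degree `1`.
    refine ⟨coordOpen ξ, le_rfl, x.2, 1, MvPolynomial.X (wedgeForms (Function.update ξ j l)),
      MvPolynomial.X (wedgeForms ξ), MvPolynomial.isHomogeneous_X _ _,
      MvPolynomial.isHomogeneous_X _ _, fun y v hv => ?_⟩
    simp only [pluckerEval, MvPolynomial.eval_X]
    have h0 : wedgeForms ξ v ≠ 0 := (wedgeForms_ne_zero_iff hv).2 y.2
    exact ⟨h0, by rw [wedgeForms_update y (fun i => hv.mem i), mul_div_cancel_right₀ _ h0]⟩
  form_vec := form_coordVec ξ

/-- The tautological sheaf is locally free. -/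
theorem exists_localFrame (x : Gr d V) :
    ∃ W : Opens (Gr d V), x ∈ W ∧ Nonempty (LocalFrame W) := by
  have := x.2.1
  let b := (Module.finBasis ℂ x.1).reindex (finCongr x.2.2)
  -- A projection of `V` onto `x` extends the dual basis of `x` to linear forms on all of `V`.
  obtain ⟨g, hg⟩ := x.1.subtype.exists_leftInverse_of_injective (Submodule.ker_subtype _)
  let ξ : Fin d → Module.Dual ℂ V := fun i => b.coord i ∘ₗ g
  refine ⟨coordOpen ξ, ?_, ⟨coordFrame ξ⟩⟩
  change Function.Injective (coordMap ξ x)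
  have : coordMap ξ x = b.equivFun.toLinearMap := by
    refine LinearMap.ext fun y => funext fun i => ?_
    have hy : g (y : V) = y := LinearMap.congr_fun hg y
    simp [coordMap, ξ, hy]
  rw [this]
  exact b.equivFun.injective

theorem exists_localFrame_le {U : Opens (Gr d V)} (x : U) :
    ∃ (W : Opens (Gr d V)) (_ : W ≤ U), x.1 ∈ W ∧ Nonempty (LocalFrame W) := by
  obtain ⟨W, hx, ⟨F⟩⟩ := exists_localFrame x.1
  exact ⟨W ⊓ U, inf_le_right, ⟨hx, x.2⟩, ⟨F.restrict inf_le_left⟩⟩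

end Frames

/-! ### Exterior powers of the tautological sheaf -/

section ExteriorPowers

variable {d : ℕ} {V : Type u} [AddCommGroup V] [Module ℂ V]

/-- The family of restrictions to the subspaces `Λ` of an alternating form on `V`. -/
def formSection (d : ℕ) {p : ℕ} (α : V [⋀^Fin p]→ₗ[ℂ] ℂ) :
    ∀ Λ : (⊤ : Opens (Gr d V)), Λ.1.1 [⋀^Fin p]→ₗ[ℂ] ℂ :=
  fun Λ => α.compLinearMap Λ.1.1.subtype

theorem LocalFrame.apply_eq_smul {W : Opens (Gr d V)} (F : LocalFrame W) {N : Type*}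
    [AddCommGroup N] [Module ℂ N] (Λ : W) (a : Λ.1.1 [⋀^Fin d]→ₗ[ℂ] N) (x : Fin d → Λ.1.1) :
    a x = wedgeForms F.form (fun i => (x i : V)) • a fun i => F.vec i Λ :=
  alternating_top_expand (F.form_comp_vec Λ) (F.sum_form_smul_vec Λ) a x

/-- Regularity of a section of `⋀^p K` is tested by fixed linear forms on `⋀^p V`. The wedge of
complementary forms of a local frame is such a form, and it returns the values of `β` on the frame
up to a nonzero constant. These values determine `β` on all sections by multilinearity. -/
theorem mem_of_altProd_mem {m p : ℕ} {U : Opens (Gr (m + p) V)}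
    {β : ∀ Λ : U, Λ.1.1 [⋀^Fin m]→ₗ[ℂ] ℂ}
    (hβ : (fun Λ : U => altProd (exteriorPower.ιMulti ℂ p) (β Λ)) ∈
      (twist (extK (m + p) V p)).sections U) :
    β ∈ (extKDual (m + p) V m).sections U := by
  intro W h k hk
  refine Reg.mem_of_local fun x => ?_
  obtain ⟨W', h', hx, ⟨F⟩⟩ := exists_localFrame_le x
  refine ⟨W', h', hx, ?_⟩
  have hvec : ∀ f : Fin m → Fin (m + p),
      (fun Λ : W' => β ⟨Λ.1, h (h' Λ.2)⟩ fun i => F.vec (f i) Λ) ∈ Reg W' := by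
    intro f
    by_cases hf : Function.Injective f
    · obtain ⟨σ, hσ⟩ := exists_perm_castAdd hf
      have hmem := hβ W' (h'.trans h) (fun i => F.vec (σ i)) (fun i => F.vec_mem _)
        (exteriorPower.alternatingMapLinearEquiv
          (wedgeForms fun j : Fin p => F.form (σ (Fin.natAdd m j))))
      convert Subalgebra.smul_mem _ hmem ((blockPerms m p).card : ℂ)⁻¹ using 1
      funext Λ
      have key := altProd_wedgeForms_perm (F.form_comp_vec Λ) σ (β ⟨Λ.1, h (h' Λ.2)⟩)
      simp only [hσ] at key
      have hg : (exteriorPower.alternatingMapLinearEquiv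
          (wedgeForms fun j : Fin p => F.form (σ (Fin.natAdd m j))) ∘ₗ
            exteriorPower.map p Λ.1.1.subtype).compAlternatingMap (exteriorPower.ιMulti ℂ p) =
          wedgeForms fun j : Fin p => F.form (σ (Fin.natAdd m j)) ∘ₗ Λ.1.1.subtype := by
        ext y
        simp only [LinearMap.compAlternatingMap_apply, LinearMap.comp_apply,
          exteriorPower.map_apply_ιMulti, exteriorPower.alternatingMapLinearEquiv_apply_ιMulti]
        rfl
      rw [← hg, ← compAlternatingMap_altProd] at key
      rw [Pi.smul_apply, eq_inv_smul_iff₀ (card_blockPerms_ne_zero m p)]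
      exact key.symm
    · have : (fun Λ : W' => β ⟨Λ.1, h (h' Λ.2)⟩ fun i => F.vec (f i) Λ) = 0 := by
        funext Λ
        refine AlternatingMap.map_eq_zero_of_not_injective _ _ fun hinj => hf fun i j hij => ?_
        exact hinj (by simp [hij])
      rw [this]
      exact zero_mem _
  have : res (F := fun _ => ℂ) h' (fun Λ : W => β ⟨Λ.1, h Λ.2⟩ fun i => k i Λ) =
      ∑ f : Fin m → Fin (m + p), (∏ i, fun Λ : W' => F.form (f i) (k i ⟨Λ.1, h' Λ.2⟩ : V)) *
        fun Λ : W' => β ⟨Λ.1, h (h' Λ.2)⟩ fun i => F.vec (f i) Λ := by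
    funext Λ
    have := multilinear_expand (β ⟨Λ.1, h (h' Λ.2)⟩).toMultilinearMap
      fun i => F.sum_form_smul_vec Λ (k i ⟨Λ.1, h' Λ.2⟩)
    rw [Finset.sum_apply]
    refine this.trans (Finset.sum_congr rfl fun f _ => ?_)
    rw [Pi.mul_apply, Finset.prod_apply]
    rfl
  rw [this]
  exact sum_mem fun f _ => mul_mem
    (prod_mem fun i _ => (taut _ V).res_mem h' (hk i) (F.form (f i))) (hvec f)

/-- If `d < p`, then `⋀^p K = 0`. -/
theorem twist_extK_generatedBy_empty {p : ℕ} (hd : d < p) :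
    (twist (extK d V p)).GeneratedBy ∅ := by
  refine ⟨Set.empty_subset _, fun U s _ x => ⟨U, le_rfl, x.2, ?_⟩⟩
  have : res (F := (twist (extK d V p)).space) le_rfl s = 0 := by
    funext Λ
    refine AlternatingMap.ext fun y => ?_
    have := Λ.1.2.1
    have h0 : Module.finrank ℂ (⋀[ℂ]^p Λ.1.1) = 0 := by
      rw [exteriorPower.finrank_eq, Λ.1.2.2, Nat.choose_eq_zero_of_lt hd]
    have := Module.finrank_zero_iff.1 h0
    exact Subsingleton.elim _ _
  rw [this]
  exact zero_mem _

/-- The global section of `⋀^p K(1)` defined by an alternating form on `V`. -/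
def altProdSection (m p : ℕ) (α : V [⋀^Fin m]→ₗ[ℂ] ℂ) :
    ∀ Λ : (⊤ : Opens (Gr (m + p) V)), Λ.1.1 [⋀^Fin (m + p)]→ₗ[ℂ] ⋀[ℂ]^p Λ.1.1 :=
  fun Λ => altProd (exteriorPower.ιMulti ℂ p) (α.compLinearMap Λ.1.1.subtype)

variable [FiniteDimensional ℂ V]

/-- The value of a multilinear form at sections of the tautological sheaf is regular. -/
theorem multilinear_apply_mem {p : ℕ} (α : MultilinearMap ℂ (fun _ : Fin p => V) ℂ)
    {W : Opens (Gr d V)} {k : Fin p → ∀ Λ : W, Λ.1.1}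
    (hk : ∀ i, k i ∈ (taut d V).sections W) :
    (fun Λ : W => α fun i => (k i Λ : V)) ∈ Reg W := by
  let b := Module.finBasis ℂ V
  have : (fun Λ : W => α fun i => (k i Λ : V)) =
      ∑ f : Fin p → Fin (Module.finrank ℂ V), (α fun i => b (f i)) •
        ∏ i, fun Λ : W => b.coord (f i) (k i Λ : V) := by
    funext Λ
    rw [multilinear_expand α (ξ := b.coord) (e := b) fun i => b.sum_repr _]
    simp [mul_comm]
  rw [this]
  exact sum_mem fun f _ => Subalgebra.smul_mem _ (prod_mem fun i _ => hk i _) _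

theorem formSection_mem {p : ℕ} (α : V [⋀^Fin p]→ₗ[ℂ] ℂ) :
    formSection d α ∈ (extKDual d V p).sections ⊤ :=
  fun _ _ _ hk => multilinear_apply_mem α.toMultilinearMap hk

theorem ιMulti_mem {p : ℕ} {W : Opens (Gr d V)} {k : Fin p → ∀ Λ : W, Λ.1.1}
    (hk : ∀ i, k i ∈ (taut d V).sections W) :
    (fun Λ : W => exteriorPower.ιMulti ℂ p fun i => k i Λ) ∈ (extK d V p).sections W := by
  intro l
  have := multilinear_apply_mem (l.compAlternatingMap (exteriorPower.ιMulti ℂ p)).toMultilinearMap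
    hk
  convert this using 2 with Λ
  rw [exteriorPower.map_apply_ιMulti]
  rfl

/-- The product of a section of `F` and a `d`-form on `V` is a section of `F(1)`. -/
theorem formSection_smul_mem {F : SectionSheaf.{u, v} d V} (α : V [⋀^Fin d]→ₗ[ℂ] ℂ)
    {W : Opens (Gr d V)} {t : ∀ Λ : W, F.space Λ} (ht : t ∈ F.sections W) :
    (fun Λ : W => (LinearMap.toSpanSingleton ℂ (F.space Λ) (t Λ)).compAlternatingMap
      (α.compLinearMap Λ.1.1.subtype)) ∈ (twist F).sections W := by
  intro W' h k hk
  exact Submodule.smul_mem _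
    (⟨_, multilinear_apply_mem α.toMultilinearMap hk⟩ : Reg W') (F.res_mem h ht)

/-- The sheaf `⋀^p K^∨` is generated by the alternating forms on `V`. -/
theorem extKDual_generatedBy (p : ℕ) :
    (extKDual d V p).GeneratedBy (Set.range (formSection d (V := V) (p := p))) := by
  refine ⟨Set.range_subset_iff.2 formSection_mem, fun U s hs x => ?_⟩
  obtain ⟨W, h, hx, ⟨F⟩⟩ := exists_localFrame_le x
  refine ⟨W, h, hx, ?_⟩
  -- The coefficients are the values of `s` on the frame; the factor `1/p!` compensates for summing
  -- over all `f` instead of the increasing ones.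
  have hreg : ∀ f : Fin p → Fin d,
      ((p.factorial : ℂ)⁻¹ • fun Λ : W => s ⟨Λ.1, h Λ.2⟩ fun i => F.vec (f i) Λ) ∈ Reg W :=
    fun f => Subalgebra.smul_mem _ (hs W h (fun i => F.vec (f i)) fun i => F.vec_mem (f i)) _
  have : res (F := (extKDual d V p).space) h s = ∑ f : Fin p → Fin d, (⟨_, hreg f⟩ : Reg W) •
      res (F := (extKDual d V p).space) (le_top : W ≤ ⊤)
        (formSection d (wedgeForms fun i => F.form (f i))) := by
    funext Λ
    refine AlternatingMap.ext fun y => ?_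
    have hexp := alternating_expand (s ⟨Λ.1, h Λ.2⟩) (x := y) fun i => F.sum_form_smul_vec Λ (y i)
    rw [← eq_inv_smul_iff₀ (Nat.cast_ne_zero.2 p.factorial_ne_zero), Finset.smul_sum] at hexp
    rw [Finset.sum_apply]
    refine Eq.trans ?_ (map_sum (⟨⟨fun a => a y, rfl⟩, fun _ _ => rfl⟩ :
      (Λ.1.1 [⋀^Fin p]→ₗ[ℂ] ℂ) →+ ℂ) _ _).symm
    refine hexp.trans (Finset.sum_congr rfl fun f _ => ?_)
    change _ = ((p.factorial : ℂ)⁻¹ * s ⟨Λ.1, h Λ.2⟩ fun i => F.vec (f i) Λ) *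
      wedgeForms (fun i => F.form (f i)) fun i => (y i : V)
    change (p.factorial : ℂ)⁻¹ * (wedgeForms (fun i => F.form (f i)) (fun i => (y i : V)) *
      s ⟨Λ.1, h Λ.2⟩ fun i => F.vec (f i) Λ) = _
    ring
  rw [this]
  exact sum_mem fun f _ => Submodule.smul_mem _ _
    (Submodule.subset_span ⟨_, ⟨_, rfl⟩, rfl⟩)

theorem altProd_mem {m p : ℕ} {U : Opens (Gr (m + p) V)}
    {β : ∀ Λ : U, Λ.1.1 [⋀^Fin m]→ₗ[ℂ] ℂ} (hβ : β ∈ (extKDual (m + p) V m).sections U) :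
    (fun Λ : U => altProd (exteriorPower.ιMulti ℂ p) (β Λ)) ∈
      (twist (extK (m + p) V p)).sections U := by
  intro W h k hk
  have : (fun Λ : W => altProd (exteriorPower.ιMulti ℂ p) (β ⟨Λ.1, h Λ.2⟩) fun i => k i Λ) =
      ∑ σ : Equiv.Perm (Fin (m + p)), (algebraMap ℂ (Reg W) ((Equiv.Perm.sign σ : ℤ) : ℂ)) •
        (⟨_, hβ W h (fun i => k (σ (Fin.castAdd p i))) fun i => hk _⟩ : Reg W) •
          fun Λ : W => exteriorPower.ιMulti ℂ p fun j => k (σ (Fin.natAdd m j)) Λ := by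
    funext Λ
    rw [altProd_apply, Finset.sum_apply]
    rfl
  rw [this]
  exact sum_mem fun σ _ => Submodule.smul_mem _ _ (Submodule.smul_mem _ _ (ιMulti_mem fun j => hk _))

variable (V) in
/-- The isomorphism `⋀^p K(1) ≅ ⋀^(d-p) K^∨`. -/
def twistExtKIso (m p : ℕ) : (twist (extK (m + p) V p)).Iso (extKDual (m + p) V m) where
  equiv Λ := haveI := Λ.2.1; (altProdEquiv m p Λ.2.2).symm
  mem_iff {U s} := by
    have hs : s = fun Λ : U => altProd (exteriorPower.ιMulti ℂ p)
        ((haveI := Λ.1.2.1; (altProdEquiv m p Λ.1.2.2).symm) (s Λ)) := by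
      funext Λ
      have := Λ.1.2.1
      exact ((altProdEquiv m p Λ.1.2.2).apply_symm_apply (s Λ)).symm
    constructor
    · intro h
      rw [hs] at h
      exact mem_of_altProd_mem h
    · intro h
      rw [hs]
      exact altProd_mem h

theorem twist_extK_generatedBy (m p : ℕ) :
    (twist (extK (m + p) V p)).GeneratedBy (Set.range (altProdSection m p (V := V))) := by
  have := (extKDual_generatedBy (d := m + p) (V := V) m).map (twistExtKIso V m p).inv_isSurjective
  rw [← Set.range_comp] at this
  exact this

theorem twist_extK_globallyGenerated (p : ℕ) : (twist (extK d V p)).GloballyGenerated := by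
  rcases lt_or_ge d p with hd | hd
  · exact (twist_extK_generatedBy_empty hd).globallyGenerated
  · obtain ⟨m, rfl⟩ := Nat.exists_eq_add_of_le' hd
    exact (twist_extK_generatedBy m p).globallyGenerated

end ExteriorPowers

/-! ### The ideal sheaf of a trilinear form -/

section Ideal

variable {d : ℕ} {V : Type u} [AddCommGroup V] [Module ℂ V]

/-- The twist preserves the surjectivity of the morphism onto the image. -/
theorem twistMap_toImage_isSurjective [FiniteDimensional ℂ V] {F : SectionSheaf.{u, v} d V}
    {G : SectionSheaf.{u, v'} d V} (φ : F.Hom G) : (twistMap φ.toImage).IsSurjective := by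
  intro U s hs x
  obtain ⟨W, h, hx, ⟨E⟩⟩ := exists_localFrame_le x
  -- The value of `s` on the frame is a section of the image and lifts locally to `t`. The lift of
  -- `s` is `t` times `wedgeForms E.form`, which equals `1` on the frame.
  obtain ⟨W', h', hx', t, ht, e⟩ := hs W h E.vec E.vec_mem ⟨x.1, hx⟩
  refine ⟨W', h'.trans h, hx', _, formSection_smul_mem (wedgeForms E.form) ht, ?_⟩
  funext Λ
  refine AlternatingMap.ext fun y => ?_
  have h1 := E.apply_eq_smul ⟨Λ.1, h' Λ.2⟩ (s ⟨Λ.1, h (h' Λ.2)⟩) y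
  refine Eq.trans ?_ h1.symm
  refine (map_smul (φ.map Λ.1) _ _).trans ?_
  exact congrArg _ (congrFun e Λ)

theorem contraction_map_ιMulti (w : V [⋀^Fin 3]→ₗ[ℂ] ℂ) (Λ : Gr d V) (y : Fin 3 → Λ.1) :
    (contraction d w).map Λ (exteriorPower.ιMulti ℂ 3 y) = w fun i => (y i : V) := by
  change exteriorPower.alternatingMapLinearEquiv w (exteriorPower.map 3 Λ.1.subtype _) = _
  rw [exteriorPower.map_apply_ιMulti, exteriorPower.alternatingMapLinearEquiv_apply_ιMulti]
  rfl

theorem contraction_map_eq_zero {w : V [⋀^Fin 3]→ₗ[ℂ] ℂ} {Λ : Gr d V}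
    (h : ∀ y : Fin 3 → Λ.1, w (fun i => (y i : V)) = 0) : (contraction d w).map Λ = 0 := by
  refine exteriorPower.linearMap_ext (AlternatingMap.ext fun y => ?_)
  exact (contraction_map_ιMulti w Λ y).trans (h y)

/-- Here the equations become linear: contraction turns the universal factor `ιMulti` into `w`
restricted to `Λ`, and a product of restrictions is the restriction of a product formed once on `V`.
-/
theorem linearSection_altProd (w : V [⋀^Fin 3]→ₗ[ℂ] ℂ) {m : ℕ} (α : V [⋀^Fin m]→ₗ[ℂ] ℂ) :
    linearSection (m + 3) (altProd w α) =
      (twistMap (contraction (m + 3) w).toImage).onFamilies ⊤ (altProdSection m 3 α) := by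
  funext Λ
  change (altProd w α).compLinearMap Λ.1.1.subtype =
    ((contraction (m + 3) w).map Λ.1).compAlternatingMap
      (altProd (exteriorPower.ιMulti ℂ 3) (α.compLinearMap Λ.1.1.subtype))
  rw [compAlternatingMap_altProd, altProd_compLinearMap]
  congr 1
  refine congrArg altProd (AlternatingMap.ext fun y => ?_)
  exact (contraction_map_ιMulti w Λ.1 y).symm

variable [FiniteDimensional ℂ V]

/-- The points where the image of the contraction vanishes are the subspaces on which the form
vanishes. -/
theorem forall_image_contraction_eq_zero_iff (w : V [⋀^Fin 3]→ₗ[ℂ] ℂ) (Λ : Gr d V) :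
    (∀ (U : Opens (Gr d V)) (h : Λ ∈ U), ∀ f ∈ (contraction d w).image.sections U,
      f ⟨Λ, h⟩ = (0 : ℂ)) ↔ ∀ y : Fin 3 → Λ.1, w (fun i => (y i : V)) = 0 := by
  constructor
  · intro h y
    obtain ⟨W, hΛ, ⟨E⟩⟩ := exists_localFrame Λ
    -- Extending the `y i` to local sections of `K` makes `w` of them a local section of the image,
    -- whose value at `Λ` is `w y`.
    choose k hk hky using fun i => E.exists_section ⟨Λ, hΛ⟩ (y i)
    have := h W hΛ _ ((contraction d w).toImage.map_mem (ιMulti_mem hk))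
    have h' := contraction_map_ιMulti w Λ fun i => k i ⟨Λ, hΛ⟩
    simp only [hky] at h' this
    rw [← h']
    exact this
  · intro h U hΛ f hf
    obtain ⟨W, hW, hx, t, -, e⟩ := hf ⟨Λ, hΛ⟩
    have := congrFun e ⟨Λ, hx⟩
    simp only [contraction_map_eq_zero h, LinearMap.zero_apply] at this
    exact this.symm

/-- The twisted image of the contraction is generated by linear forms in the Plücker
coordinates. -/
theorem twist_image_contraction_generatedBy (w : V [⋀^Fin 3]→ₗ[ℂ] ℂ) :
    (twist (contraction d w).image).GeneratedBy (linearSection d ''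
      {φ | linearSection d φ ∈ (twist (contraction d w).image).sections ⊤}) := by
  have hsub : linearSection d '' {φ | linearSection d φ ∈
      (twist (contraction d w).image).sections ⊤} ⊆ (twist (contraction d w).image).sections ⊤ := by
    rintro _ ⟨φ, hφ, rfl⟩
    exact hφ
  rcases lt_or_ge d 3 with hd | hd
  · have := (twist_extK_generatedBy_empty (V := V) hd).map
      (twistMap_toImage_isSurjective (contraction d w))
    rw [Set.image_empty] at this
    exact this.mono (Set.empty_subset _) hsub
  · obtain ⟨m, rfl⟩ := Nat.exists_eq_add_of_le' hd
    have := (twist_extK_generatedBy (V := V) m 3).map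
      (twistMap_toImage_isSurjective (contraction (m + 3) w))
    refine this.mono ?_ hsub
    rintro _ ⟨_, ⟨α, rfl⟩, rfl⟩
    refine ⟨altProd w α, ?_, linearSection_altProd w α⟩
    refine (linearSection_altProd w α ▸ this.1 ⟨_, ⟨α, rfl⟩, rfl⟩ : linearSection (m + 3)
      (altProd w α) ∈ (twist (contraction (m + 3) w).image).sections ⊤)

/-- If the twist of a subsheaf of `𝒪` is generated by linear forms, then its zero locus is
defined by these linear forms. -/
theorem forall_sections_eq_zero_iff {w : V [⋀^Fin 3]→ₗ[ℂ] ℂ} {S : Set (V [⋀^Fin d]→ₗ[ℂ] ℂ)}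
    (hS : (twist (contraction d w).image).GeneratedBy (linearSection d '' S)) (Λ : Gr d V) :
    (∀ (U : Opens (Gr d V)) (h : Λ ∈ U), ∀ f ∈ (contraction d w).image.sections U,
      f ⟨Λ, h⟩ = (0 : ℂ)) ↔ ∀ φ ∈ S, ∀ v : Fin d → V, (∀ i, v i ∈ Λ.1) → φ v = 0 := by
  constructor
  · intro h φ hφ v hv
    obtain ⟨W, hΛ, ⟨E⟩⟩ := exists_localFrame Λ
    choose k hk hky using fun i => E.exists_section ⟨Λ, hΛ⟩ ⟨v i, hv i⟩
    have := h W hΛ _ (hS.1 ⟨φ, hφ, rfl⟩ W le_top k hk)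
    simp only [hky] at this
    exact this
  · intro h U hΛ f hf
    obtain ⟨W, hW, hx, ⟨E⟩⟩ := exists_localFrame_le (⟨Λ, hΛ⟩ : U)
    -- Multiplying `f` by the wedge of the frame forms puts it in the twist, where it is locally a
    -- combination of linear sections vanishing at `Λ`. Evaluating on the frame, where the wedge is
    -- `1`, recovers `f` at `Λ`.
    obtain ⟨W', hW', hx', hspan⟩ := hS.2 W _ (formSection_smul_mem (wedgeForms E.form)
      ((contraction d w).image.res_mem hW hf)) ⟨Λ, hx⟩
    have hzero : ∀ s ∈ Submodule.span (Reg W') (res (F := (twist (contraction d w).image).space)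
        (le_top : W' ≤ ⊤) '' (linearSection d '' S)), s ⟨Λ, hx'⟩ = 0 := by
      intro s hs
      induction hs using Submodule.span_induction with
      | mem s hs =>
        obtain ⟨_, ⟨φ, hφ, rfl⟩, rfl⟩ := hs
        exact AlternatingMap.ext fun y => h φ hφ _ fun i => (y i).2
      | zero => rfl
      | add s t _ _ hs ht => rw [Pi.add_apply, hs, ht, add_zero]
      | smul c s _ hs =>
        change c.1 ⟨Λ, hx'⟩ • s ⟨Λ, hx'⟩ = 0
        rw [hs, smul_zero]
    have h0 := DFunLike.congr_fun (hzero _ hspan) fun i => E.vec i ⟨Λ, hx⟩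
    have h1 : wedgeForms E.form (fun i => (E.vec i ⟨Λ, hx⟩ : V)) • f ⟨Λ, hΛ⟩ = (0 : ℂ) := h0
    rwa [wedgeForms_apply_eq_one (E.form_vec ⟨Λ, hx⟩), one_smul] at h1

end Ideal

/-! ### Nullspaces -/

section Nullspaces

variable {𝔤 : Type u} [LieRing 𝔤] [LieAlgebra ℂ 𝔤]

theorem isNullspace_iff (W : Submodule ℂ 𝔤) :
    IsNullspace W ↔ ∀ y : Fin 3 → W, cartanForm 𝔤 (fun i => (y i : 𝔤)) = 0 :=
  ⟨fun h y => h _ (y 0).2 _ (y 1).2 _ (y 2).2,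
    fun h x hx y hy z hz => h ![⟨x, hx⟩, ⟨y, hy⟩, ⟨z, hz⟩]⟩

theorem zeroLocusY_eq [FiniteDimensional ℂ 𝔤] (d : ℕ) :
    zeroLocusY 𝔤 d = {Λ | IsNullspace Λ.1} :=
  Set.ext fun Λ => (forall_image_contraction_eq_zero_iff (cartanForm 𝔤) Λ).trans
    (isNullspace_iff Λ.1).symm

/-- Comparison with `W₀` shows that every maximal nullspace has dimension `d`, and that a nullspace
of dimension `d` cannot be exceeded. -/
theorem setOf_isMaximalNullspace_eq [FiniteDimensional ℂ 𝔤] {d : ℕ} {W₀ : Submodule ℂ 𝔤}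
    (h₀ : IsMaximalNullspace W₀) (hd : Module.finrank ℂ W₀ = d) :
    {W : Submodule ℂ 𝔤 | IsMaximalNullspace W} = Subtype.val '' zeroLocusY 𝔤 d := by
  rw [zeroLocusY_eq]
  ext W
  constructor
  · intro hW
    exact ⟨⟨W, inferInstance, hd ▸ le_antisymm (h₀.2 W hW.1) (hW.2 W₀ h₀.1)⟩, hW.1, rfl⟩
  · rintro ⟨Λ, hΛ, rfl⟩
    exact ⟨hΛ, fun W' hW' => (h₀.2 W' hW').trans_eq (hd.trans Λ.2.2.symm)⟩

end Nullspaces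

end NullGr

end

open NullGr in
theorem theorem9 {𝔤 : Type*} [LieRing 𝔤] [LieAlgebra ℂ 𝔤] [FiniteDimensional ℂ 𝔤]
    [LieAlgebra.IsSemisimple ℂ 𝔤] (d : ℕ) :
    -- `Y`, the zero locus of `I_Y` in the Grassmannian, consists of the nullspaces of dimension `d`
    zeroLocusY 𝔤 d = {Λ | IsNullspace Λ.1} ∧
    -- `⋀^3 K(1) ≅ ⋀^(d-3) K^∨`, and this sheaf is generated by its global sections
    (∀ m : ℕ, d = m + 3 →
      Nonempty ((twist (extK d 𝔤 3)).Iso (extKDual d 𝔤 m)) ∧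
      (extKDual d 𝔤 m).GloballyGenerated) ∧
    (twist (extK d 𝔤 3)).GloballyGenerated ∧
    -- `⋀^3 K(1)` surjects onto `I_Y(1)`
    (twistMap (toIdealY 𝔤 d)).IsSurjective ∧
    -- `I_Y(1)` is generated by its global sections
    (twist (idealY 𝔤 d)).GloballyGenerated ∧
    -- more precisely, by linear forms in the Plücker coordinates
    (twist (idealY 𝔤 d)).GeneratedBy (linearSection d '' linearEquations 𝔤 d) ∧
    -- as a set, `Y` is the locus in the Grassmannian where these linear forms vanish
    zeroLocusY 𝔤 d =
      {Λ | ∀ φ ∈ linearEquations 𝔤 d, ∀ v : Fin d → 𝔤, (∀ i, v i ∈ Λ.1) → φ v = 0} ∧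
    -- if `d` is the dimension of the maximal nullspaces, `Y` is the set of all of them
    ((∃ W : Submodule ℂ 𝔤, IsMaximalNullspace W ∧ Module.finrank ℂ W = d) →
      {W : Submodule ℂ 𝔤 | IsMaximalNullspace W} = Subtype.val '' zeroLocusY 𝔤 d) := by
  have hgen : (twist (idealY 𝔤 d)).GeneratedBy (linearSection d '' linearEquations 𝔤 d) :=
    twist_image_contraction_generatedBy (cartanForm 𝔤)
  refine ⟨zeroLocusY_eq d, ?_, twist_extK_globallyGenerated 3,
    twistMap_toImage_isSurjective (contraction d (cartanForm 𝔤)), hgen.globallyGenerated, hgen,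
    Set.ext fun Λ => forall_sections_eq_zero_iff hgen Λ, ?_⟩
  · rintro m rfl
    exact ⟨⟨twistExtKIso 𝔤 m 3⟩, (extKDual_generatedBy m).globallyGenerated⟩
  · rintro ⟨W, hW, hd⟩
    exact setOf_isMaximalNullspace_eq hW hd
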